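/- Let $\mathcal X,\mathcal Y,U$ be real normed linear spaces, let $D$ be a set, let $Z^+=\{0,1,2,\dots\}$, and let $f:Z^+\times D\times\mathcal X\times U\to\mathcal X$ and $H:Z^+\times\mathcal X\to\mathcal Y$. Consider the system $$x(t+1)=f(t,d(t),x(t),u(t)),\qquad Y(t)=H(t,x(t)),\qquad t\in Z^+,\tag{1.2}$$ and the unforced system $$x(t+1)=f(t,d(t),x(t),0),\qquad Y(t)=H(t,x(t)),\qquad t\in Z^+.\tag{1.3}$$ $M_D$ and $M_U$ denote the sets of all sequences $d=(d(t))_{t\in Z^+}$ in $D$ and $u=(u(t))_{t\in Z^+}$ in $U$. For given data, $x(t)$, $t\ge t_0$, denotes the solution with $x(t_0)=x_0$. Assume: (A2) for all bounded sets $S\subset\mathcal X\times U$, $I\subset Z^+$ and every $\varepsilon>0$, the set $f(I\times D\times S)$ is bounded and there is $\delta>0$ such that $\sup_{d\in D}\|f(t,d,x,u)-f(t,d,x_0,u_0)\|_{\mathcal X}<\varepsilon$ for all $t\in I$ and $(x,u),(x_0,u_0)\in S$ with $\|x-x_0\|_{\mathcal X}+\|u-u_0\|_U<\delta$; moreover $f(t,d,0,0)=0$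 for all $(t,d)\in Z^+\times D$; (H2) for all bounded sets $I\subset Z^+$, $S\subset\mathcal X$ and every $\varepsilon>0$, the set $H(I\times S)$ is bounded and there is $\delta>0$ such that $\|H(t,x)-H(t,x_0)\|_{\mathcal Y}<\varepsilon$ for all $t\in I$ and $x,x_0\in S$ with $\|x-x_0\|_{\mathcal X}<\delta$; moreover $H(t,0)=0$ for all $t\in Z^+$. Then the following two properties are equivalent. **(Non-uniform in time IOS of (1.2).)** There exist $\sigma\in KL$, $\beta,\gamma\in K^+$ and $\rho\in K_\infty$ such that for all $u\in M_U$, $(t_0,x_0,d)\in Z^+\times\mathcal X\times M_D$ and all integers $t\ge t_0$ the solution of (1.2) satisfies $$\|H(t,x(t))\|_{\mathcal Y}\le\max\Big\{\sigma(\beta(t_0)\|x_0\|_{\mathcal X},\,t-t_0),\ \sup_{\tau\in\{t_0,\dots,t\}}\sigma\big(\beta(\tau)\rho(\gamma(\tau)\|u(\tau)\|_U),\,t-\tau\big)\Big\}.$$ **(Non-uniform in time RGAOS of (1.3).)** The solutions of (1.3) satisfy both of the following. P1 (robust output stability): for every $\varepsilon>0$ and $T\in Z^+$, $$\sup\{\|H(t,x(t))\|_{\mathcal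 Y}:\ t\ge t_0,\ \|x_0\|_{\mathcal X}\le\varepsilon,\ t_0\in\{0,\dots,T\},\ d\in M_D\}<+\infty,$$ and there is $\delta>0$ such that $\|x_0\|_{\mathcal X}\le\delta$ and $t_0\in\{0,\dots,T\}$ imply $\|H(t,x(t))\|_{\mathcal Y}\le\varepsilon$ for all $t\ge t_0$ and $d\in M_D$. P2 (robust output attractivity): for every $\varepsilon>0$, $T\in Z^+$ and $R\ge0$ there is $\tau\in Z^+$ such that $\|x_0\|_{\mathcal X}\le R$ and $t_0\in\{0,\dots,T\}$ imply $\|H(t,x(t))\|_{\mathcal Y}\le\varepsilon$ for all $t\ge t_0+\tau$ and $d\in M_D$. Here $K^+$ is the set of continuous positive functions on $[0,+\infty)$; $K$ is the set of continuous strictly increasing $a:[0,+\infty)\to[0,+\infty)$ with $a(0)=0$; $K_\infty$ is the set of unbounded functions in $K$; and $KL$ is the set of continuous $\sigma:[0,+\infty)^2\to[0,+\infty)$ such that $\sigma(\cdot,r)\in K$ for each $r\ge 0$ and, for each $s\ge 0$, $\sigma(s,\cdot)$ is non-increasing with $\lim_{r\to+\infty}\sigma(s,r)=0$. -/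

import Mathlib

open scoped NNReal

/-- Class `K`: continuous, strictly increasing functions on `[0, ∞)` vanishing at `0`. -/
def ClassK (a : ℝ≥0 → ℝ≥0) : Prop :=
  Continuous a ∧ StrictMono a ∧ a 0 = 0

/-- Class `K_∞`: the unbounded functions of class `K`. -/
def ClassKInfty (a : ℝ≥0 → ℝ≥0) : Prop :=
  ClassK a ∧ Filter.Tendsto a Filter.atTop Filter.atTop

/-- Class `KL`: jointly continuous `σ(s, r)`, of class `K` in `s` for each fixed `r`, and
non-increasing in `r` with limit `0` as `r → ∞` for each fixed `s`. -/
def ClassKL (σ : ℝ≥0 → ℝ≥0 → ℝ≥0) : Prop :=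
  Continuous (fun p : ℝ≥0 × ℝ≥0 => σ p.1 p.2) ∧
  (∀ r, ClassK (fun s => σ s r)) ∧
  (∀ s, Antitone (σ s) ∧ Filter.Tendsto (σ s) Filter.atTop (nhds 0))

/-- Class `K^+`: continuous positive functions on `[0, ∞)`. -/
def ClassKPlus (β : ℝ≥0 → ℝ≥0) : Prop :=
  Continuous β ∧ ∀ t, 0 < β t

section Systems

variable {X Y U D : Type*}

/-- The solution of the recursion `x(t+1) = F t (x t)`, `t ≥ t₀`, with `x(t₀) = x₀`.
Only its values at times `t ≥ t₀` are meaningful; at earlier times it is set to `x₀`. -/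
def solution (F : ℕ → X → X) (t₀ : ℕ) (x₀ : X) : ℕ → X
  | 0 => x₀
  | t + 1 => if t₀ ≤ t then F t (solution F t₀ x₀ t) else x₀

theorem solution_initial (F : ℕ → X → X) (t₀ : ℕ) (x₀ : X) :
    solution F t₀ x₀ t₀ = x₀ := by
  cases t₀ <;> simp [solution]

theorem solution_step (F : ℕ → X → X) (t₀ : ℕ) (x₀ : X) (t : ℕ) (h : t₀ ≤ t) :
    solution F t₀ x₀ (t + 1) = F t (solution F t₀ x₀ t) := by
  simp [solution, h]

variable [NormedAddCommGroup X] [NormedAddCommGroup Y] [NormedAddCommGroup U]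

/-- Hypothesis (H2) on the output map: `H` is bounded and uniformly continuous on bounded sets
(locally uniformly in time), and vanishes at the origin. -/
def HypH2 (H : ℕ → X → Y) : Prop :=
  (∀ (I : Set ℕ) (S : Set X), Bornology.IsBounded I → Bornology.IsBounded S →
    ∀ ε : ℝ, 0 < ε →
      Bornology.IsBounded {y : Y | ∃ t ∈ I, ∃ x ∈ S, y = H t x} ∧
      ∃ δ : ℝ, 0 < δ ∧ ∀ t ∈ I, ∀ x ∈ S, ∀ x' ∈ S, ‖x - x'‖ < δ → ‖H t x - H t x'‖ < ε) ∧
  (∀ t, H t 0 = 0)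

/-- Hypothesis (A2), continuity of the dynamics: `f` is bounded and uniformly continuous on
bounded sets of states and inputs (locally uniformly in time, uniformly in the disturbance), and
the origin is an equilibrium for the zero input. The supremum over `d` is that of a bounded
family, by the first requirement. -/
def HypA2 (f : ℕ → D → X → U → X) : Prop :=
  (∀ (S : Set (X × U)) (I : Set ℕ), Bornology.IsBounded S → Bornology.IsBounded I →
    ∀ ε : ℝ, 0 < ε →
      Bornology.IsBounded {y : X | ∃ t ∈ I, ∃ d : D, ∃ p ∈ S, y = f t d p.1 p.2} ∧
      ∃ δ : ℝ, 0 < δ ∧ ∀ t ∈ I, ∀ p ∈ S, ∀ q ∈ S, ‖p.1 - q.1‖ + ‖p.2 - q.2‖ < δ →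
        (⨆ d : D, ‖f t d p.1 p.2 - f t d q.1 q.2‖) < ε) ∧
  (∀ t d, f t d 0 0 = 0)

/-- Non-uniform in time Robust Global Asymptotic Output Stability of the system
`x(t+1) = f(t, d(t), x(t))`, `Y(t) = H(t, x(t))`: robust output stability (boundedness and
the `ε`-`δ` property) together with robust output attractivity. -/
def IsRGAOS (f : ℕ → D → X → X) (H : ℕ → X → Y) : Prop :=
  (∀ (ε : ℝ) (T : ℕ), 0 < ε →
    BddAbove {r : ℝ | ∃ (t₀ t : ℕ) (x₀ : X) (d : ℕ → D), t₀ ≤ T ∧ t₀ ≤ t ∧ ‖x₀‖ ≤ ε ∧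
      r = ‖H t (solution (fun s x => f s (d s) x) t₀ x₀ t)‖} ∧
    ∃ δ : ℝ, 0 < δ ∧ ∀ (t₀ : ℕ) (x₀ : X), ‖x₀‖ ≤ δ → t₀ ≤ T →
      ∀ t, t₀ ≤ t → ∀ d : ℕ → D,
        ‖H t (solution (fun s x => f s (d s) x) t₀ x₀ t)‖ ≤ ε) ∧
  (∀ (ε : ℝ) (T : ℕ) (R : ℝ), 0 < ε → 0 ≤ R →
    ∃ τ : ℕ, ∀ (t₀ : ℕ) (x₀ : X), ‖x₀‖ ≤ R → t₀ ≤ T →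
      ∀ t, t₀ + τ ≤ t → ∀ d : ℕ → D,
        ‖H t (solution (fun s x => f s (d s) x) t₀ x₀ t)‖ ≤ ε)

/-- Non-uniform in time Input-to-Output Stability, from the input `u`, of the system
`x(t+1) = f(t, d(t), x(t), u(t))`, `Y(t) = H(t, x(t))`. -/
def IsIOS (f : ℕ → D → X → U → X) (H : ℕ → X → Y) : Prop :=
  ∃ (σ : ℝ≥0 → ℝ≥0 → ℝ≥0) (β γ ρ : ℝ≥0 → ℝ≥0),
    ClassKL σ ∧ ClassKPlus β ∧ ClassKPlus γ ∧ ClassKInfty ρ ∧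
    ∀ (u : ℕ → U) (t₀ : ℕ) (x₀ : X) (d : ℕ → D) (t : ℕ), t₀ ≤ t →
      ‖H t (solution (fun s x => f s (d s) x (u s)) t₀ x₀ t)‖₊ ≤
        max (σ (β t₀ * ‖x₀‖₊) ((t - t₀ : ℕ) : ℝ≥0))
          ((Finset.Icc t₀ t).sup fun τ =>
            σ (β τ * ρ (γ τ * ‖u τ‖₊)) ((t - τ : ℕ) : ℝ≥0))

end Systems

/-! IOS implies RGAOS by putting `u = 0`. For the converse, RGAOS yields a decay estimate `α (b n *
8⁻ᵏ)` for the unforced outputs after `k` steps, uniform over initial times and states bounded by `n`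
(`IsRGAOS.exists_decay`). Let `V(t, x)` be the least `v` such that every unforced output from `(t,
x)` is at most `α (v / 4ᵏ)` after `k` steps. Then `V` drops by a factor 4 along each unforced step
(`OutputEnvelope.step`). The gap between the rates 8 and 4 leaves only finitely many `k` to control,
so `V` is uniformly continuous on bounded sets (`exists_outputEnvelope_modulus`).

Continuity turns the unforced decrease into `V⁺ ≤ V/4 + a(β(t)‖u‖)/4 ≤ max(V, a(β(t)‖u‖))/2`, as
long as state and input lie in balls depending on `t` (`exists_gain`). If instead some datum exceeds
`t + 1`, its size bounds the elapsed time, and `a` is chosen large enough for this datum alone to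
dominate `V`. By induction `V` is bounded by one fading term, from the initial state or a past input
(`exists_fading_memory`). This is the IOS estimate with `σ(s, r) = α(2⁻ʳ a(s))`. -/

/-! ### Comparison functions -/

/-- The function `p s` is the infimum of the bounds valid on all of `[0, s]`; closedness makes the
infimum itself a valid bound. -/
theorem exists_monotone_bound {P : ℝ≥0 → ℝ≥0 → Prop}
    (mono : ∀ s b b', b ≤ b' → P s b → P s b')
    (closed : ∀ s b, (∀ b', b < b' → P s b') → P s b)
    (small : ∀ ε, 0 < ε → ∀ᶠ s in nhds 0, P s ε)
    (bdd : ∀ n : ℕ, ∃ C, ∀ s : ℝ≥0, s ≤ n → P s C) :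
    ∃ p : ℝ≥0 → ℝ≥0, Monotone p ∧ (∀ s, P s (p s)) ∧
      ∀ ε, 0 < ε → ∃ δ, 0 < δ ∧ ∀ s, s < δ → p s ≤ ε := by
  have ne : ∀ s : ℝ≥0, {b | ∀ s', s' ≤ s → P s' b}.Nonempty := by
    intro s
    obtain ⟨n, hn⟩ := exists_nat_ge s
    obtain ⟨C, hC⟩ := bdd n
    exact ⟨C, fun s' hs' => hC s' (hs'.trans hn)⟩
  refine ⟨fun s => sInf {b | ∀ s', s' ≤ s → P s' b}, ?_, ?_, ?_⟩
  · intro s t hst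
    exact csInf_le_csInf (OrderBot.bddBelow _) (ne t) fun b hb s' hs' => hb s' (hs'.trans hst)
  · intro s
    refine closed s _ fun b' hb' => ?_
    obtain ⟨b, hb, hbb⟩ := exists_lt_of_csInf_lt (ne s) hb'
    exact mono s b b' hbb.le (hb s le_rfl)
  · intro ε hε
    obtain ⟨δ, hδ, h⟩ := NNReal.nhds_zero_basis.eventually_iff.1 (small ε hε)
    exact ⟨δ, hδ, fun s hs => csInf_le (OrderBot.bddBelow _)
      fun s' hs' => h (Set.mem_Iio.2 (hs'.trans_lt hs))⟩

/-- A monotone function vanishing at `0+` is dominated by a class `K_∞` function growing at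
least as fast as the identity. -/
theorem exists_classKInfty_ge {p : ℝ≥0 → ℝ≥0} (hp : Monotone p)
    (small : ∀ ε, 0 < ε → ∃ δ, 0 < δ ∧ ∀ s, s < δ → p s ≤ ε) :
    ∃ a : ℝ≥0 → ℝ≥0, ClassKInfty a ∧ (∀ s h, a s + h ≤ a (s + h)) ∧ ∀ s, p s ≤ a s := by
  set q : ℝ → ℝ := fun s => p s.toNNReal with hq
  have qm : Monotone q := fun s t hst => NNReal.coe_le_coe.2 (hp (Real.toNNReal_le_toNNReal hst))
  have qcm : ∀ s : ℝ≥0, Monotone fun r => q (s * r) := fun s r r' h =>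
    qm (mul_le_mul_of_nonneg_left h s.2)
  have qi : ∀ s : ℝ≥0, IntervalIntegrable (fun r => q (s * r)) MeasureTheory.volume 1 2 :=
    fun s => (qcm s).intervalIntegrable
  -- Averaging `p` over `[s, 2s]` gives a value between `p s` and `p (2 * s)`. Away from 0 it is
  -- continuous because a substitution turns it into a difference of primitives divided by `s`.
  set I : ℝ≥0 → ℝ := fun s => ∫ r in (1:ℝ)..2, q (s * r) with hI
  have Im : Monotone I := by
    intro s t hst
    refine intervalIntegral.integral_mono_on (by norm_num) (qi s) (qi t) fun r hr => ?_
    exact qm (mul_le_mul_of_nonneg_right (NNReal.coe_le_coe.2 hst) (by linarith [hr.1]))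
  have Ilow : ∀ s : ℝ≥0, (p s : ℝ) ≤ I s := by
    intro s
    have h : ∫ r in (1:ℝ)..2, q s ≤ I s := by
      refine intervalIntegral.integral_mono_on (by norm_num) (by simp) (qi s) fun r hr => ?_
      exact qm (le_mul_of_one_le_right s.2 hr.1)
    have h2 : ∫ r in (1:ℝ)..2, q s = p s := by
      simp only [intervalIntegral.integral_const, hq, Real.toNNReal_coe]
      norm_num
    linarith
  have Iup : ∀ s : ℝ≥0, I s ≤ p (2 * s) := by
    intro s
    have h : I s ≤ ∫ r in (1:ℝ)..2, q (2 * s) := by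
      refine intervalIntegral.integral_mono_on (by norm_num) (qi s) (by simp) fun r hr => ?_
      exact qm (by nlinarith [hr.2, s.2])
    have h2 : ∫ r in (1:ℝ)..2, q (2 * s) = p (2 * s) := by
      have : (2 * (s:ℝ)).toNNReal = 2 * s := by
        rw [← Real.toNNReal_coe (r := 2 * s)]; simp
      simp only [intervalIntegral.integral_const, hq, this]
      norm_num
    linarith
  have I0 : I 0 = 0 := by
    refine le_antisymm (le_of_forall_pos_le_add fun ε hε => ?_) ((p 0).2.trans (Ilow 0))
    obtain ⟨δ, hδ, h⟩ := small ⟨ε, hε.le⟩ hε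
    have := NNReal.coe_le_coe.2 (h (2 * 0) (by simpa using hδ))
    rw [zero_add]
    exact (Iup 0).trans this
  have Ic : Continuous I := by
    rw [continuous_iff_continuousAt]
    intro s
    rcases eq_or_ne s 0 with rfl | hs
    · rw [Metric.continuousAt_iff]
      intro ε hε
      obtain ⟨δ, hδ, h⟩ := small ⟨ε / 2, by positivity⟩ (by exact_mod_cast half_pos hε)
      refine ⟨δ / 2, by positivity, fun {t} ht => ?_⟩
      have ht' : 2 * t < δ := by
        rw [NNReal.dist_eq] at ht
        simp only [NNReal.coe_zero, sub_zero, NNReal.abs_eq] at ht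
        rw [← NNReal.coe_lt_coe]; push_cast; linarith
      have h1 := NNReal.coe_le_coe.2 (h _ ht')
      have h2 := Iup t
      have h3 := (p t).2.trans (Ilow t)
      rw [I0, Real.dist_eq, sub_zero, abs_of_nonneg h3]
      change (p (2 * t) : ℝ) ≤ ε / 2 at h1
      linarith
    · have qii : ∀ a b, IntervalIntegrable q MeasureTheory.volume a b :=
        fun a b => qm.intervalIntegrable
      have hΦ : Continuous fun b => ∫ r in (0:ℝ)..b, q r :=
        intervalIntegral.continuous_primitive qii 0
      have hform : ∀ t : ℝ≥0, t ≠ 0 →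
          I t = (t : ℝ)⁻¹ * ((∫ r in (0:ℝ)..(t * 2), q r) - ∫ r in (0:ℝ)..t, q r) := by
        intro t ht
        have ht' : (t : ℝ) ≠ 0 := by exact_mod_cast ht
        rw [intervalIntegral.integral_interval_sub_left (qii _ _) (qii _ _)]
        simp only [hI]
        rw [intervalIntegral.integral_comp_mul_left _ ht']
        simp
      have hc : ContinuousAt (fun t : ℝ≥0 =>
          (t : ℝ)⁻¹ * ((∫ r in (0:ℝ)..(t * 2), q r) - ∫ r in (0:ℝ)..t, q r)) s := by
        refine ContinuousAt.mul ?_ (Continuous.continuousAt ?_)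
        · exact (NNReal.continuous_coe.continuousAt).inv₀ (by exact_mod_cast hs)
        · exact (hΦ.comp (by fun_prop)).sub (hΦ.comp NNReal.continuous_coe)
      refine hc.congr ?_
      filter_upwards [isOpen_ne.mem_nhds hs] with t ht using (hform t ht).symm
  set J : ℝ≥0 → ℝ≥0 := fun s => (I s).toNNReal with hJ
  have Jm : Monotone J := fun s t hst => Real.toNNReal_le_toNNReal (Im hst)
  have hgrow : ∀ s h, s + J s + h ≤ s + h + J (s + h) := fun s h => by
    have : J s ≤ J (s + h) := Jm (by simp)
    calc s + J s + h = s + h + J s := by ring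
      _ ≤ _ := by gcongr
  -- The summand `s` supplies strict monotonicity, unboundedness and growth at least that of the
  -- identity.
  refine ⟨fun s => s + J s, ⟨⟨by fun_prop, ?_, by simp [hJ, I0]⟩, ?_⟩, hgrow, fun s => ?_⟩
  · exact strictMono_id.add_monotone Jm
  · exact Filter.tendsto_atTop_mono (fun s => le_self_add) Filter.tendsto_id
  · exact le_add_left (NNReal.le_toNNReal_of_coe_le (Ilow s))

/-- After rescaling `s` by a gain `β τ`, the bound `1 / (τ + 1)` suffices for all `s ≤ τ + 1`. On a
bounded range of `s`, or for a given accuracy near 0, only finitely many `τ` then remain, so the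
bounds can be taken uniform in `τ`. This is the source of all the gains below. -/
theorem exists_classKInfty_of_family {P : ℕ → ℝ≥0 → ℝ≥0 → Prop}
    (mono : ∀ τ s b b', b ≤ b' → P τ s b → P τ s b')
    (closed : ∀ τ s b, (∀ b', b < b' → P τ s b') → P τ s b)
    (small : ∀ τ ε, 0 < ε → ∀ᶠ s in nhds 0, P τ s ε)
    (bdd : ∀ (τ n : ℕ), ∃ C, ∀ s : ℝ≥0, s ≤ n → P τ s C) :
    ∃ (a : ℝ≥0 → ℝ≥0) (β : ℕ → ℝ≥0), ClassKInfty a ∧ (∀ s h, a s + h ≤ a (s + h)) ∧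
      (∀ τ, 1 ≤ β τ) ∧ ∀ τ s, P τ s (a (β τ * s)) := by
  have hβ : ∀ τ : ℕ, ∃ β : ℝ≥0, 1 ≤ β ∧ ∀ s : ℝ≥0, s ≤ τ + 1 → P τ (s / β) (1 / (τ + 1)) := by
    intro τ
    obtain ⟨δ, hδ, h⟩ := NNReal.nhds_zero_basis.eventually_iff.1
      (small τ (1 / (τ + 1)) (by positivity))
    refine ⟨max 1 ((τ + 2) / δ), le_max_left _ _, fun s hs => h ?_⟩
    rw [Set.mem_Iio, div_lt_iff₀ (by positivity)]
    calc s ≤ (τ : ℝ≥0) + 1 := hs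
      _ < τ + 2 := by gcongr; norm_num
      _ = δ * ((τ + 2) / δ) := by field_simp
      _ ≤ _ := by gcongr; exact le_max_right _ _
  choose β hβ1 hβ using hβ
  have hdiv : ∀ τ s, s / β τ ≤ s := fun τ s => div_le_self (by simp) (hβ1 τ)
  obtain ⟨p, hpm, hpP, hp0⟩ := exists_monotone_bound (P := fun s b => ∀ τ, P τ (s / β τ) b)
    (fun s b b' h hP τ => mono _ _ _ _ h (hP τ))
    (fun s b h τ => closed _ _ _ fun b' hb' => h b' hb' τ)
    (by
      intro ε hε
      obtain ⟨N, hN⟩ := exists_nat_one_div_lt (K := ℝ≥0) hε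
      have h1 : ∀ᶠ s : ℝ≥0 in nhds 0, ∀ τ ∈ Finset.range N, P τ (s / β τ) ε := by
        rw [Filter.eventually_all_finset]
        intro τ _
        have : Filter.Tendsto (fun s : ℝ≥0 => s / β τ) (nhds 0) (nhds 0) := by
          have hc : Continuous fun s : ℝ≥0 => s / β τ := by fun_prop
          simpa using hc.tendsto 0
        exact this.eventually (small τ ε hε)
      filter_upwards [h1, Iio_mem_nhds (zero_lt_one (α := ℝ≥0))] with s hs hs1 τ
      by_cases hτ : τ < N
      · exact hs τ (Finset.mem_range.2 hτ)
      · refine mono _ _ _ _ ?_ (hβ τ s (hs1.le.trans (by simp)))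
        refine le_trans ?_ hN.le
        have : (N : ℝ≥0) ≤ τ := by exact_mod_cast not_lt.1 hτ
        gcongr)
    (by
      intro n
      choose C hC using fun τ => bdd τ n
      refine ⟨1 + ∑ τ ∈ Finset.range n, C τ, fun s hs τ => ?_⟩
      by_cases hτ : τ < n
      · refine mono _ _ _ _ ?_ (hC τ _ ((hdiv τ s).trans hs))
        exact le_add_left (Finset.single_le_sum (f := C) (fun _ _ => zero_le)
          (Finset.mem_range.2 hτ))
      · have : (n : ℝ≥0) ≤ τ := by exact_mod_cast not_lt.1 hτ
        refine mono _ _ _ _ ?_ (hβ τ s (hs.trans (this.trans (by simp))))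
        refine le_add_right (div_le_one_of_le₀ (by simp) (by simp)))
  obtain ⟨a, ha, hag, hpa⟩ := exists_classKInfty_ge hpm hp0
  refine ⟨a, β, ha, hag, hβ1, fun τ s => ?_⟩
  have h := hpP (β τ * s) τ
  rw [mul_div_cancel_left₀ _ (zero_lt_one.trans_le (hβ1 τ)).ne'] at h
  exact mono _ _ _ _ (hpa _) h

/-- The family lemma applies to a condition placed only at the points `s = n`, its index being a
dummy. The value `n = 0` is excluded because class `K` functions vanish there; the constant `β 0 +
1` covers it and gives positivity. -/
theorem exists_classKPlus_ge (β : ℕ → ℝ≥0) :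
    ∃ b : ℝ≥0 → ℝ≥0, ClassKPlus b ∧ ∀ n : ℕ, β n ≤ b n := by
  obtain ⟨a, c, ha, -, -, h⟩ := exists_classKInfty_of_family
    (P := fun _ s b => ∀ n : ℕ, 0 < n → s = n → β n ≤ b)
    (fun _ _ _ _ h hP n hn hs => (hP n hn hs).trans h)
    (fun _ s b h n hn hs => le_of_forall_gt_imp_ge_of_dense fun b' hb' => h b' hb' n hn hs)
    (by
      intro _ ε _
      filter_upwards [Iio_mem_nhds (zero_lt_one (α := ℝ≥0))] with s hs n hn hsn
      rw [hsn, Set.mem_Iio] at hs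
      exact absurd hs (not_lt.2 (by exact_mod_cast hn)))
    (by
      intro _ n
      refine ⟨∑ i ∈ Finset.range (n + 1), β i, fun s hs i _ hi => ?_⟩
      refine Finset.single_le_sum (f := β) (fun _ _ => zero_le) (Finset.mem_range.2 ?_)
      rw [hi] at hs
      exact Nat.lt_succ_of_le (by exact_mod_cast hs))
  have hac : Continuous a := ha.1.1
  refine ⟨fun s => a (c 0 * s) + (β 0 + 1), ⟨by fun_prop, fun t => by positivity⟩, fun n => ?_⟩
  rcases Nat.eq_zero_or_pos n with rfl | hn
  · simp [ha.1.2.2]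
  · exact le_add_right (h 0 n n hn rfl)

/-! ### Restarting and comparing trajectories -/

section Flow

variable {X : Type*}

theorem solution_congr {F G : ℕ → X → X} {t₀ : ℕ} (h : ∀ s, t₀ ≤ s → F s = G s) (x₀ : X)
    (k : ℕ) : solution F t₀ x₀ (t₀ + k) = solution G t₀ x₀ (t₀ + k) := by
  induction k with
  | zero => simp only [add_zero, solution_initial]
  | succ k ih =>
    rw [← add_assoc, solution_step _ _ _ _ (Nat.le_add_right _ _),
      solution_step _ _ _ _ (Nat.le_add_right _ _), ih, h _ (Nat.le_add_right _ _)]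

theorem solution_restart (F : ℕ → X → X) (t₀ : ℕ) (x₀ : X) (k : ℕ) :
    solution F (t₀ + 1) (F t₀ x₀) (t₀ + 1 + k) = solution F t₀ x₀ (t₀ + 1 + k) := by
  induction k with
  | zero =>
    rw [add_zero, solution_initial, solution_step _ _ _ _ le_rfl, solution_initial]
  | succ k ih =>
    rw [← add_assoc, solution_step _ _ _ _ (Nat.le_add_right _ _),
      solution_step _ _ _ _ (by omega), ih]

end Flow

/-! ### The Lyapunov function as an output envelope -/

section Envelope

variable {X Y U D : Type*} [NormedAddCommGroup Y] [NormedAddCommGroup U]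
variable {f : ℕ → D → X → U → X} {H : ℕ → X → Y}

/-- The trajectory of the unforced system. -/
abbrev unforced (f : ℕ → D → X → U → X) (d : ℕ → D) : ℕ → X → ℕ → X :=
  solution fun s x => f s (d s) x 0

/-- All outputs of the unforced system started at `x` at time `t` are dominated by the
exponentially decaying envelope `k ↦ α (v / 4 ^ k)`. The least such `v` is a Lyapunov function. -/
def OutputEnvelope (f : ℕ → D → X → U → X) (H : ℕ → X → Y) (α : ℝ≥0 → ℝ≥0)
    (t : ℕ) (x : X) (v : ℝ≥0) : Prop :=
  ∀ (d : ℕ → D) (k : ℕ), ‖H (t + k) (unforced f d t x (t + k))‖₊ ≤ α (v / 4 ^ k)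

variable {α : ℝ≥0 → ℝ≥0} {t : ℕ} {x : X} {v w : ℝ≥0}

theorem OutputEnvelope.mono (hα : Monotone α) (h : OutputEnvelope f H α t x v) (hvw : v ≤ w) :
    OutputEnvelope f H α t x w := fun d k =>
  (h d k).trans (hα (by gcongr))

theorem OutputEnvelope.of_forall_gt (hα : Continuous α)
    (h : ∀ w, v < w → OutputEnvelope f H α t x w) : OutputEnvelope f H α t x v := by
  intro d k
  have hc : Continuous fun w : ℝ≥0 => α (w / 4 ^ k) := by fun_prop
  refine ge_of_tendsto ((hc.tendsto v).mono_left (nhdsWithin_le_nhds (s := Set.Ioi v))) ?_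
  filter_upwards [self_mem_nhdsWithin] with w hw using h w hw d k

theorem OutputEnvelope.output_le [Nonempty D] (h : OutputEnvelope f H α t x v) :
    ‖H t x‖₊ ≤ α v := by
  obtain ⟨d⟩ := ‹Nonempty D›
  have := h (fun _ => d) 0
  rwa [add_zero, unforced, solution_initial, pow_zero, div_one] at this

/-- Any disturbance from time `t + 1` on can be given the value `d` at time `t`, so the outputs
after the step are outputs from `(t, x)` delayed by one, which gains one factor 4. -/
theorem OutputEnvelope.step (h : OutputEnvelope f H α t x v) (d : D) :
    OutputEnvelope f H α (t + 1) (f t d x 0) (v / 4) := by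
  intro d' k
  have h1 := h (Function.update d' t d) (k + 1)
  have h2 := solution_restart (fun s x => f s (Function.update d' t d s) x 0) t x k
  simp only [Function.update_self] at h2
  rw [unforced, show t + (k + 1) = t + 1 + k by ring, ← h2] at h1
  rw [solution_congr (G := fun s x => f s (d' s) x 0)] at h1
  · rwa [div_div, ← pow_succ']
  · intro s hs
    simp only [Function.update_of_ne (show s ≠ t by omega)]

theorem OutputEnvelope.of_decay (hα : Monotone α) {β : ℝ≥0}
    (h : ∀ d k, ‖H (t + k) (unforced f d t x (t + k))‖₊ ≤ α (β * (1 / 8) ^ k)) :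
    OutputEnvelope f H α t x β := by
  refine fun d k => (h d k).trans (hα ?_)
  rw [one_div, div_eq_mul_inv, ← inv_pow]
  gcongr
  norm_num

end Envelope

/-! ### Uniform bounds, moduli of continuity and decay -/

section Estimates

variable {X Y U D : Type*}
variable [NormedAddCommGroup X] [NormedAddCommGroup Y] [NormedAddCommGroup U]
variable {f : ℕ → D → X → U → X} {H : ℕ → X → Y}

theorem isBounded_norm_le_prod (r : ℝ) :
    Bornology.IsBounded {p : X × U | ‖p.1‖ ≤ r ∧ ‖p.2‖ ≤ r} :=
  isBounded_iff_forall_norm_le.2 ⟨r, fun _ hp => max_le hp.1 hp.2⟩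

theorem HypA2.exists_bound (hf : HypA2 f) (n : ℕ) :
    ∃ C : ℕ, ∀ t, t ≤ n → ∀ d x u, ‖x‖ ≤ n → ‖u‖ ≤ n → ‖f t d x u‖ ≤ C := by
  obtain ⟨C, hC⟩ := isBounded_iff_forall_norm_le.1
    (hf.1 _ _ (isBounded_norm_le_prod (n : ℝ)) (Set.finite_Iic n).isBounded 1 one_pos).1
  obtain ⟨m, hm⟩ := exists_nat_ge C
  exact ⟨m, fun t ht d x u hx hu => (hC _ ⟨t, ht, d, (x, u), ⟨hx, hu⟩, rfl⟩).trans hm⟩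

theorem HypA2.exists_modulus (hf : HypA2 f) (n : ℕ) {ε : ℝ} (hε : 0 < ε) :
    ∃ δ : ℝ, 0 < δ ∧ ∀ t, t ≤ n → ∀ d x u x' u', ‖x‖ ≤ n → ‖u‖ ≤ n → ‖x'‖ ≤ n → ‖u'‖ ≤ n →
      ‖x - x'‖ + ‖u - u'‖ < δ → ‖f t d x u - f t d x' u'‖ < ε := by
  obtain ⟨δ, hδ, h⟩ :=
    (hf.1 _ _ (isBounded_norm_le_prod (n : ℝ)) (Set.finite_Iic n).isBounded ε hε).2
  obtain ⟨C, hC⟩ := hf.exists_bound n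
  refine ⟨δ, hδ, fun t ht d x u x' u' hx hu hx' hu' hd => ?_⟩
  refine lt_of_le_of_lt ?_ (h t ht (x, u) ⟨hx, hu⟩ (x', u') ⟨hx', hu'⟩ hd)
  refine le_ciSup (f := fun d => ‖f t d x u - f t d x' u'‖) ⟨C + C, ?_⟩ d
  rintro _ ⟨d, rfl⟩
  exact (norm_sub_le _ _).trans (add_le_add (hC t ht d x u hx hu) (hC t ht d x' u' hx' hu'))

theorem HypH2.exists_modulus (hH : HypH2 H) (n : ℕ) {ε : ℝ} (hε : 0 < ε) :
    ∃ δ : ℝ, 0 < δ ∧ ∀ t, t ≤ n → ∀ x x', ‖x‖ ≤ n → ‖x'‖ ≤ n → ‖x - x'‖ < δ →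
      ‖H t x - H t x'‖ < ε := by
  obtain ⟨δ, hδ, h⟩ := (hH.1 _ {x : X | ‖x‖ ≤ n} (Set.finite_Iic n).isBounded
    (isBounded_iff_forall_norm_le.2 ⟨n, fun _ hx => hx⟩) ε hε).2
  exact ⟨δ, hδ, fun t ht x x' hx hx' hd => h t ht x hx x' hx' hd⟩

/-- Robust forward completeness: states stay bounded as long as inputs do. -/
theorem HypA2.exists_reach_bound (hf : HypA2 f) :
    ∃ h : ℕ → ℕ → ℕ, (∀ m, Monotone fun t => h t m) ∧
      ∀ (u : ℕ → U) (t₀ : ℕ) (x₀ : X) (d : ℕ → D) (m t : ℕ), t₀ ≤ t → ‖x₀‖ ≤ m →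
        (∀ τ, t₀ ≤ τ → τ < t → ‖u τ‖ ≤ m) →
        ‖solution (fun s x => f s (d s) x (u s)) t₀ x₀ t‖ ≤ h t m := by
  choose C hC using hf.exists_bound
  let h : ℕ → ℕ → ℕ := fun t m => Nat.rec m (fun t b => max b (C (max t b))) t
  have hs : ∀ t m, h (t + 1) m = max (h t m) (C (max t (h t m))) := fun _ _ => rfl
  have hm : ∀ m, Monotone fun t => h t m := fun m =>
    monotone_nat_of_le_succ fun t => (hs t m).symm ▸ le_max_left _ _
  have hge : ∀ t m, m ≤ h t m := fun t m => hm m (Nat.zero_le t)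
  refine ⟨h, hm, fun u t₀ x₀ d m t ht hx hu => ?_⟩
  induction t, ht using Nat.le_induction with
  | base =>
    rw [solution_initial]
    exact hx.trans (by exact_mod_cast hge t₀ m)
  | succ t ht ih =>
    rw [solution_step _ _ _ _ ht]
    have h1 := ih fun τ h1 h2 => hu τ h1 (h2.trans t.lt_succ_self)
    have h2 : ‖u t‖ ≤ ((max t (h t m) : ℕ) : ℝ) :=
      (hu t ht t.lt_succ_self).trans (by exact_mod_cast (hge t m).trans (le_max_right _ _))
    refine (hC (max t (h t m)) t (le_max_left _ _) (d t) _ (u t) (h1.trans ?_) h2).trans ?_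
    · exact_mod_cast le_max_right _ _
    · rw [hs]
      exact_mod_cast le_max_right _ _

theorem HypA2.exists_unforced_bound (hf : HypA2 f) (n : ℕ) :
    ∃ C : ℕ, n ≤ C ∧ ∀ t k, t ≤ n → k ≤ n → ∀ x d, ‖x‖ ≤ n → ‖unforced f d t x (t + k)‖ ≤ C := by
  obtain ⟨h, hm, hh⟩ := hf.exists_reach_bound
  refine ⟨max n (h (n + n) n), le_max_left _ _, fun t k ht hk x d hx => ?_⟩
  refine (hh (fun _ => 0) t x d n (t + k) (Nat.le_add_right _ _) hx (by simp)).trans ?_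
  exact_mod_cast (hm n (add_le_add ht hk)).trans (le_max_right _ _)

theorem HypA2.exists_unforced_modulus (hf : HypA2 f) (n k : ℕ) {ε : ℝ} (hε : 0 < ε) :
    ∃ δ : ℝ, 0 < δ ∧ ∀ t, t ≤ n → ∀ x x' d, ‖x‖ ≤ n → ‖x'‖ ≤ n → ‖x - x'‖ < δ →
      ‖unforced f d t x (t + k) - unforced f d t x' (t + k)‖ < ε := by
  induction k generalizing ε with
  | zero =>
    refine ⟨ε, hε, fun t _ x x' d _ _ h => ?_⟩
    simpa only [add_zero, unforced, solution_initial] using h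
  | succ k ih =>
    obtain ⟨C, hC, hb⟩ := hf.exists_unforced_bound (n + k)
    obtain ⟨δ₁, hδ₁, h₁⟩ := hf.exists_modulus C hε
    obtain ⟨δ, hδ, h⟩ := ih hδ₁
    have hn : ∀ x : X, ‖x‖ ≤ n → ‖x‖ ≤ ((n + k : ℕ) : ℝ) := fun x hx =>
      hx.trans (by exact_mod_cast Nat.le_add_right _ _)
    refine ⟨δ, hδ, fun t ht x x' d hx hx' hd => ?_⟩
    rw [unforced, ← add_assoc, solution_step _ _ _ _ (Nat.le_add_right _ _),
      solution_step _ _ _ _ (Nat.le_add_right _ _)]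
    refine h₁ (t + k) ((add_le_add_left ht k).trans hC) _ _ _ _ _
      (hb t k (by omega) (by omega) x d (hn x hx)) (by simp)
      (hb t k (by omega) (by omega) x' d (hn x' hx')) (by simp) ?_
    simpa using h t ht x x' d hx hx' hd

theorem exists_output_modulus (hf : HypA2 f) (hH : HypH2 H) (n K : ℕ) {ε : ℝ} (hε : 0 < ε) :
    ∃ δ : ℝ, 0 < δ ∧ ∀ k, k < K → ∀ t, t ≤ n → ∀ x x' d, ‖x‖ ≤ n → ‖x'‖ ≤ n → ‖x - x'‖ < δ →
      ‖H (t + k) (unforced f d t x (t + k)) - H (t + k) (unforced f d t x' (t + k))‖ < ε := by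
  induction K with
  | zero => exact ⟨1, one_pos, fun k hk => absurd hk (Nat.not_lt_zero k)⟩
  | succ K ih =>
    obtain ⟨δ, hδ, h⟩ := ih
    obtain ⟨C, hC, hb⟩ := hf.exists_unforced_bound (n + K)
    obtain ⟨δ₁, hδ₁, h₁⟩ := hH.exists_modulus C hε
    obtain ⟨δ₂, hδ₂, h₂⟩ := hf.exists_unforced_modulus n K hδ₁
    have hn : ∀ x : X, ‖x‖ ≤ n → ‖x‖ ≤ ((n + K : ℕ) : ℝ) := fun x hx =>
      hx.trans (by exact_mod_cast Nat.le_add_right _ _)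
    refine ⟨min δ δ₂, lt_min hδ hδ₂, fun k hk t ht x x' d hx hx' hd => ?_⟩
    rcases Nat.lt_succ_iff_lt_or_eq.1 hk with hk | rfl
    · exact h k hk t ht x x' d hx hx' (hd.trans_le (min_le_left _ _))
    · exact h₁ _ ((add_le_add_left ht k).trans hC) _ _
        (hb t k (by omega) (by omega) x d (hn x hx))
        (hb t k (by omega) (by omega) x' d (hn x' hx'))
        (h₂ t ht x x' d hx hx' (hd.trans_le (min_le_right _ _)))

theorem unforced_zero (hf : HypA2 f) (d : ℕ → D) (t k : ℕ) :
    unforced f d t 0 (t + k) = 0 := by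
  induction k with
  | zero => exact solution_initial _ _ _
  | succ k ih =>
    rw [unforced, ← add_assoc, solution_step _ _ _ _ (Nat.le_add_right _ _)]
    rw [unforced] at ih
    rw [ih, hf.2]

/-- The family lemma is used with time encoded as `s = 8⁻ᵏ`: attractivity is smallness as `s → 0`,
and the bound on outputs in P1 is boundedness for bounded `s`. -/
theorem IsRGAOS.exists_decay (hR : IsRGAOS (fun t d x => f t d x 0) H) :
    ∃ (α : ℝ≥0 → ℝ≥0) (β : ℕ → ℝ≥0), ClassKInfty α ∧ (∀ s h, α s + h ≤ α (s + h)) ∧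
      ∀ n t k : ℕ, t ≤ n → ∀ x d, ‖x‖ ≤ n →
        ‖H (t + k) (unforced f d t x (t + k))‖₊ ≤ α (β n * (1 / 8) ^ k) := by
  obtain ⟨α, β, hα, hαg, -, h⟩ := exists_classKInfty_of_family
    (P := fun n s b => ∀ t k, t ≤ n → ∀ x d, ‖x‖ ≤ n → s = (1 / 8) ^ k →
      ‖H (t + k) (unforced f d t x (t + k))‖₊ ≤ b)
    (fun _ _ _ _ h hP t k ht x d hx hs => (hP t k ht x d hx hs).trans h)
    (fun _ s b h t k ht x d hx hs =>
      le_of_forall_gt_imp_ge_of_dense fun b' hb' => h b' hb' t k ht x d hx hs)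
    (by
      intro n ε hε
      obtain ⟨τ, hτ⟩ := hR.2 ε n n hε n.cast_nonneg
      filter_upwards [Iio_mem_nhds (show (0 : ℝ≥0) < (1 / 8) ^ τ by positivity)]
        with s hs t k ht x d hx hsk
      rw [hsk, Set.mem_Iio, pow_lt_pow_iff_right_of_lt_one₀ (by positivity)
        (by rw [div_lt_one] <;> norm_num)] at hs
      exact hτ t x hx ht (t + k) (by omega) d)
    (by
      intro n m
      obtain ⟨C, hC⟩ := (hR.1 (n + 1) n (by positivity)).1
      refine ⟨C.toNNReal, fun s _ t k ht x d hx _ => NNReal.le_toNNReal_of_coe_le ?_⟩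
      exact hC ⟨t, t + k, x, d, ht, Nat.le_add_right _ _, hx.trans (by simp), rfl⟩)
  exact ⟨α, β, hα, hαg, fun n t k ht x d hx => h n _ t k ht x d hx rfl⟩

variable {α : ℝ≥0 → ℝ≥0} {t : ℕ} {x : X}

theorem OutputEnvelope.zero (hf : HypA2 f) (hH : HypH2 H) (t : ℕ) :
    OutputEnvelope f H α t 0 0 := by
  intro d k
  rw [unforced_zero hf, hH.2, nnnorm_zero]
  exact zero_le

/-- The Lyapunov function is uniformly continuous on bounded sets. -/
theorem exists_outputEnvelope_modulus (hf : HypA2 f) (hH : HypH2 H) (hα : Monotone α)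
    (hαg : ∀ s h, α s + h ≤ α (s + h)) {n : ℕ} {β : ℝ≥0}
    (hβ : ∀ t k, t ≤ n → ∀ x d, ‖x‖ ≤ n →
      ‖H (t + k) (unforced f d t x (t + k))‖₊ ≤ α (β * (1 / 8) ^ k))
    {ε : ℝ≥0} (hε : 0 < ε) :
    ∃ δ : ℝ, 0 < δ ∧ ∀ t, t ≤ n → ∀ x x' v, ‖x‖ ≤ n → ‖x'‖ ≤ n → ‖x - x'‖ < δ →
      OutputEnvelope f H α t x v → OutputEnvelope f H α t x' (v + ε) := by
  -- Since `8⁻ᵏ = 2⁻ᵏ 4⁻ᵏ`, from `K` on the decay estimate alone fits under the envelope of `ε`. For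
  -- the finitely many earlier `k`, an output error `ε / 4 ^ K` is enough, and `hαg` moves it inside
  -- `α`.
  obtain ⟨K, hK⟩ : ∃ K : ℕ, β * (1 / 2) ^ K ≤ ε := by
    have h0 : Filter.Tendsto (fun k : ℕ => β * (1 / 2 : ℝ≥0) ^ k) Filter.atTop (nhds (β * 0)) :=
      (NNReal.tendsto_pow_atTop_nhds_zero_of_lt_one
        (by rw [div_lt_one] <;> norm_num)).const_mul β
    rw [mul_zero] at h0
    exact ((h0.eventually (Iio_mem_nhds hε)).mono fun _ h => le_of_lt h).exists
  have hη : 0 < ε / 4 ^ K := by positivity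
  obtain ⟨δ, hδ, h⟩ := exists_output_modulus hf hH n K (ε := (ε / 4 ^ K : ℝ≥0)) hη
  refine ⟨δ, hδ, fun t ht x x' v hx hx' hd hv d k => ?_⟩
  rcases lt_or_ge k K with hk | hk
  · have h1 := h k hk t ht x x' d hx hx' hd
    have h2 : ‖H (t + k) (unforced f d t x' (t + k))‖₊ ≤
        ‖H (t + k) (unforced f d t x (t + k))‖₊ + ε / 4 ^ K := by
      rw [← NNReal.coe_le_coe, NNReal.coe_add, coe_nnnorm, coe_nnnorm]
      have := norm_sub_norm_le (H (t + k) (unforced f d t x' (t + k)))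
        (H (t + k) (unforced f d t x (t + k)))
      rw [norm_sub_rev] at this
      linarith
    refine h2.trans ((add_le_add_left (hv d k) _).trans ((hαg _ _).trans (hα ?_)))
    rw [add_div]
    gcongr
    norm_num
  · refine (hβ t k ht x' d hx').trans (hα ?_)
    have h8 : (1 / 8 : ℝ≥0) ^ k = (1 / 2) ^ k / 4 ^ k := by
      rw [← div_pow]; congr 1; rw [div_div]; norm_num
    rw [h8, ← mul_div_assoc]
    gcongr
    refine le_trans ?_ (hK.trans le_add_self)
    exact mul_le_mul_right (pow_le_pow_of_le_one zero_le
      (div_le_one_of_le₀ (by norm_num) (by norm_num)) hk) β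

end Estimates

/-! ### The two implications -/

section Main

variable {X Y U D : Type*}
variable [NormedAddCommGroup X] [NormedAddCommGroup Y] [NormedAddCommGroup U]
variable {f : ℕ → D → X → U → X} {H : ℕ → X → Y}

theorem IsIOS.isRGAOS (h : IsIOS f H) : IsRGAOS (fun t d x => f t d x 0) H := by
  obtain ⟨σ, β, γ, ρ, hσ, hβ, hγ, hρ, h⟩ := h
  have σ0 : ∀ r, σ 0 r = 0 := fun r => (hσ.2.1 r).2.2
  have σm : ∀ r, Monotone fun s => σ s r := fun r => (hσ.2.1 r).2.1.monotone
  have key : ∀ t₀ t x₀ (d : ℕ → D), t₀ ≤ t →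
      ‖H t (solution (fun s x => f s (d s) x 0) t₀ x₀ t)‖₊ ≤
        σ (β t₀ * ‖x₀‖₊) ((t - t₀ : ℕ) : ℝ≥0) := by
    intro t₀ t x₀ d ht
    refine (h (fun _ => 0) t₀ x₀ d t ht).trans (max_le le_rfl (Finset.sup_le fun τ _ => ?_))
    simp [hρ.1.2.2, σ0]
  have hB : ∀ T : ℕ, ∃ B : ℝ≥0, 0 < B ∧ ∀ t₀ : ℕ, t₀ ≤ T → β t₀ ≤ B := by
    intro T
    refine ⟨∑ i ∈ Finset.range (T + 1), β i, ?_, fun t ht => ?_⟩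
    · exact Finset.sum_pos (fun i _ => hβ.2 _) ⟨0, by simp⟩
    · exact Finset.single_le_sum (f := fun i : ℕ => β i) (fun _ _ => zero_le)
        (Finset.mem_range.2 (Nat.lt_succ_of_le ht))
  have key2 : ∀ T B (r : ℝ≥0), (∀ t₀ : ℕ, t₀ ≤ T → β t₀ ≤ B) → ∀ t₀ : ℕ, t₀ ≤ T →
      ∀ τ t, t₀ + τ ≤ t → ∀ x₀ : X, ‖x₀‖₊ ≤ r → ∀ d : ℕ → D,
      ‖H t (solution (fun s x => f s (d s) x 0) t₀ x₀ t)‖₊ ≤ σ (B * r) τ := by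
    intro T B r hB t₀ ht₀ τ t ht x₀ hx d
    refine (key t₀ t x₀ d (by omega)).trans ?_
    refine ((σm _) (mul_le_mul' (hB t₀ ht₀) hx)).trans ((hσ.2.2 _).1 ?_)
    exact_mod_cast (by omega : τ ≤ t - t₀)
  refine ⟨fun ε T hε => ⟨?_, ?_⟩, fun ε T R hε hR => ?_⟩
  · obtain ⟨B, -, hB⟩ := hB T
    refine ⟨σ (B * ε.toNNReal) 0, ?_⟩
    rintro _ ⟨t₀, t, x₀, d, hT, ht, hx, rfl⟩
    have := key2 T B ε.toNNReal hB t₀ hT 0 t (by simpa using ht) x₀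
      (NNReal.le_toNNReal_of_coe_le hx) d
    rw [Nat.cast_zero] at this
    exact_mod_cast this
  · obtain ⟨B, hB0, hB⟩ := hB T
    have hc : Filter.Tendsto (fun s => σ s 0) (nhds 0) (nhds 0) := by
      simpa only [σ0] using (hσ.2.1 0).1.tendsto 0
    obtain ⟨δ, hδ, h⟩ := NNReal.nhds_zero_basis.eventually_iff.1
      (hc.eventually (Iio_mem_nhds (Real.toNNReal_pos.2 hε)))
    refine ⟨(δ / (2 * B) : ℝ≥0), by positivity, fun t₀ x₀ hx hT t ht d => ?_⟩
    have h1 := key2 T B (δ / (2 * B)) hB t₀ hT 0 t (by simpa using ht) x₀ hx d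
    have h2 : B * (δ / (2 * B)) < δ := by
      rw [show B * (δ / (2 * B)) = δ / 2 by field_simp]
      exact NNReal.half_lt_self hδ.ne'
    rw [Nat.cast_zero] at h1
    have h3 := h1.trans (le_of_lt (h h2))
    exact (Real.le_toNNReal_iff_coe_le hε.le).1 h3
  · obtain ⟨B, -, hB⟩ := hB T
    have hc := ((hσ.2.2 (B * R.toNNReal)).2.comp tendsto_natCast_atTop_atTop).eventually
      (Iio_mem_nhds (Real.toNNReal_pos.2 hε))
    obtain ⟨τ, hτ⟩ := hc.exists
    refine ⟨τ, fun t₀ x₀ hx hT t ht d => ?_⟩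
    have h1 := key2 T B R.toNNReal hB t₀ hT τ t ht x₀ (NNReal.le_toNNReal_of_coe_le hx) d
    exact (Real.le_toNNReal_iff_coe_le hε.le).1 (h1.trans (le_of_lt hτ))

theorem classKL_comp_exp {α a : ℝ≥0 → ℝ≥0} (hα : ClassK α) (ha : ClassK a) :
    ClassKL fun s r => α ((1 / 2 : ℝ≥0) ^ (r : ℝ) * a s) := by
  have hαc := hα.1
  have hac := ha.1
  have hpc : Continuous fun r : ℝ≥0 => (1 / 2 : ℝ≥0) ^ (r : ℝ) := by
    refine continuous_iff_continuousAt.2 fun r => ?_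
    exact (continuousAt_const.nnrpow NNReal.continuous_coe.continuousAt (Or.inl (by norm_num)))
  have hp : ∀ r : ℝ≥0, 0 < (1 / 2 : ℝ≥0) ^ (r : ℝ) := fun r => NNReal.rpow_pos (by norm_num)
  have h1 : (1 / 2 : ℝ≥0) < 1 := by rw [div_lt_one] <;> norm_num
  refine ⟨?_, fun r => ⟨by fun_prop, ?_, by simp [ha.2.2, hα.2.2]⟩, fun s => ⟨?_, ?_⟩⟩
  · exact hαc.comp ((hpc.comp continuous_snd).mul (hac.comp continuous_fst))
  · exact fun s t hst => hα.2.1 (mul_lt_mul_of_pos_left (ha.2.1 hst) (hp r))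
  · intro r r' h
    refine hα.2.1.monotone (mul_le_mul_left ?_ _)
    exact NNReal.rpow_le_rpow_of_exponent_ge (by norm_num) h1.le h
  · have h2 : Filter.Tendsto (fun r : ℝ≥0 => (1 / 2 : ℝ≥0) ^ (r : ℝ)) Filter.atTop (nhds 0) := by
      rw [← NNReal.tendsto_coe]
      simp only [NNReal.coe_rpow]
      exact (tendsto_rpow_atTop_of_base_lt_one ((1 / 2 : ℝ≥0) : ℝ) (by norm_num)
        (by exact_mod_cast h1)).comp (NNReal.tendsto_coe_atTop.2 Filter.tendsto_id)
    have h3 := (hαc.tendsto (0 * a s)).comp (h2.mul_const (a s))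
    simpa only [zero_mul, hα.2.2, Function.comp_def] using h3

/-- One class `K_∞` function `a` and one sequence of gains `β` control the initial value of the
Lyapunov function, its growth along small inputs, and the growth `Q` reachable with large data. -/
theorem exists_gain (hf : HypA2 f) (hH : HypH2 H) {α : ℝ≥0 → ℝ≥0} {b : ℕ → ℝ≥0}
    (hα : ClassKInfty α) (hαg : ∀ s h, α s + h ≤ α (s + h))
    (hb : ∀ n t k : ℕ, t ≤ n → ∀ x d, ‖x‖ ≤ n →
        ‖H (t + k) (unforced f d t x (t + k))‖₊ ≤ α (b n * (1 / 8) ^ k))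
    (r : ℕ → ℕ) (Q : ℕ → ℝ≥0) :
    ∃ (a : ℝ≥0 → ℝ≥0) (β : ℕ → ℝ≥0), ClassKInfty a ∧
      (∀ τ x, OutputEnvelope f H α τ x (a (β τ * ‖x‖₊))) ∧
      (∀ τ s, 1 < s → Q ⌈s⌉₊ ≤ a (β τ * s)) ∧
      (∀ τ x u d v, ‖x‖ ≤ r τ → ‖u‖ ≤ τ + 1 → OutputEnvelope f H α τ x v →
        OutputEnvelope f H α (τ + 1) (f τ d x u) (v / 4 + a (β τ * ‖u‖₊) / 4)) := by
  have αm : Monotone α := hα.1.2.1.monotone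
  have αc : Continuous α := hα.1.1
  have hmod := fun n {ε : ℝ≥0} (hε : 0 < ε) =>
    exists_outputEnvelope_modulus hf hH αm hαg (hb n) hε
  obtain ⟨a, β, ha, -, -, h⟩ := exists_classKInfty_of_family
    (P := fun τ s c => (∀ x, ‖x‖₊ = s → OutputEnvelope f H α τ x c) ∧
      (1 < s → Q ⌈s⌉₊ ≤ c) ∧
      (∀ x u d v, ‖x‖ ≤ r τ → ‖u‖ ≤ τ + 1 → ‖u‖₊ = s → OutputEnvelope f H α τ x v →
        OutputEnvelope f H α (τ + 1) (f τ d x u) (v / 4 + c / 4)))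
    (fun τ s c c' hc ⟨h1, h2, h3⟩ => ⟨fun x hx => (h1 x hx).mono αm hc,
      fun hs => (h2 hs).trans hc,
      fun x u d v hx hu hus hv => (h3 x u d v hx hu hus hv).mono αm (by gcongr)⟩)
    (fun τ s c h => ⟨fun x hx => .of_forall_gt αc fun w hw => (h w hw).1 x hx,
      fun hs => le_of_forall_gt_imp_ge_of_dense fun w hw => (h w hw).2.1 hs,
      fun x u d v hx hu hus hv => .of_forall_gt αc fun w hw => by
        -- The bound `c' = 4 * (w - v / 4)` is the one for which `v / 4 + c' / 4 = w`.
        have hw' : c < 4 * (w - v / 4) := by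
          have h4 : c / 4 < w - v / 4 := lt_tsub_iff_left.2 hw
          rwa [div_lt_iff₀' (by norm_num)] at h4
        have hvw : v / 4 ≤ w := le_self_add.trans hw.le
        have := (h _ hw').2.2 x u d v hx hu hus hv
        rwa [mul_div_cancel_left₀ _ (by norm_num), add_tsub_cancel_of_le hvw] at this⟩)
    (by
      intro τ ε hε
      -- For small `s`: `δ₁` compares `x` with the origin, whose envelope is 0; `δ₂` and `δ₃`
      -- compare the forced successor with the unforced one, whose envelope is `v / 4`. The
      -- condition on `Q` is void for `s < 1`.
      obtain ⟨δ₁, hδ₁, h₁⟩ := hmod (τ + 1) hε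
      obtain ⟨C, hC⟩ := hf.exists_bound (max τ (r τ) + 1)
      obtain ⟨δ₂, hδ₂, h₂⟩ := hmod (max (τ + 1) C) (show 0 < ε / 4 by positivity)
      obtain ⟨δ₃, hδ₃, h₃⟩ := hf.exists_modulus (max τ (r τ) + 1) hδ₂
      have hlt : ∀ δ : ℝ, 0 < δ → ∀ᶠ s : ℝ≥0 in nhds 0, (s : ℝ) < δ := fun δ hδ =>
        (NNReal.continuous_coe.tendsto 0).eventually (Iio_mem_nhds hδ)
      filter_upwards [hlt _ hδ₁, hlt _ hδ₃, hlt 1 one_pos] with s hs₁ hs₃ hs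
      refine ⟨fun x hx => ?_, fun h => absurd (NNReal.coe_lt_coe.2 h) hs.le.not_gt,
        fun x u d v hx hu hus hv => ?_⟩
      · have hxs : ‖x‖ = s := congrArg NNReal.toReal hx
        have hx1 : ‖x‖ ≤ ((τ + 1 : ℕ) : ℝ) := by
          rw [hxs]; push_cast; linarith [(Nat.cast_nonneg τ : (0:ℝ) ≤ τ)]
        simpa using h₁ τ (Nat.le_succ τ) 0 x 0 (by simpa using by positivity) hx1 (by simpa [hxs])
          (.zero hf hH τ)
      · have hus' : ‖u‖ = s := congrArg NNReal.toReal hus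
        have hx1 : ‖x‖ ≤ ((max τ (r τ) + 1 : ℕ) : ℝ) := hx.trans (by
          exact_mod_cast (le_max_right _ _).trans (Nat.le_succ _))
        have hu1 : ‖u‖ ≤ ((max τ (r τ) + 1 : ℕ) : ℝ) := hu.trans (by
          exact_mod_cast Nat.succ_le_succ (le_max_left _ _))
        have hτ : τ ≤ max τ (r τ) + 1 := (le_max_left _ _).trans (Nat.le_succ _)
        have hCm : (C : ℝ) ≤ ((max (τ + 1) C : ℕ) : ℝ) := by exact_mod_cast le_max_right _ _
        refine h₂ (τ + 1) (le_max_left _ _) (f τ d x 0) _ _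
          ((hC τ hτ d x 0 hx1 (by simpa using by positivity)).trans hCm)
          ((hC τ hτ d x u hx1 hu1).trans hCm) ?_ (hv.step d)
        exact h₃ τ hτ d x 0 x u hx1 (by simpa using by positivity) hx1 hu1 (by simpa [hus']))
    (by
      intro τ n
      obtain ⟨C, hC⟩ := hf.exists_bound (max τ (r τ) + 1)
      -- One summand per condition. The factor 4 cancels the division of the gain by 4 in the last
      -- one, where the successor state is merely bounded by `C`.
      refine ⟨b (max τ n) + (∑ i ∈ Finset.range (n + 1), Q i + 4 * b (max (τ + 1) C)),
        fun s hs => ⟨fun x hx => ?_, fun _ => ?_, fun x u d v hx hu hus hv => ?_⟩⟩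
      · have hx' : ‖x‖ ≤ ((max τ n : ℕ) : ℝ) := by
          have h1 : ‖x‖ ≤ n := by rw [← coe_nnnorm, hx]; exact_mod_cast hs
          exact h1.trans (by exact_mod_cast le_max_right _ _)
        exact (OutputEnvelope.of_decay αm fun d k =>
          hb (max τ n) τ k (le_max_left _ _) x d hx').mono αm le_self_add
      · refine le_add_left (le_add_right ?_)
        refine Finset.single_le_sum (f := Q) (fun _ _ => zero_le) (Finset.mem_range.2 ?_)
        exact Nat.lt_succ_of_le (Nat.ceil_le.2 hs)
      · have hx1 : ‖x‖ ≤ ((max τ (r τ) + 1 : ℕ) : ℝ) := hx.trans (by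
          exact_mod_cast (le_max_right _ _).trans (Nat.le_succ _))
        have hu1 : ‖u‖ ≤ ((max τ (r τ) + 1 : ℕ) : ℝ) := hu.trans (by
          exact_mod_cast Nat.succ_le_succ (le_max_left _ _))
        have hτ : τ ≤ max τ (r τ) + 1 := (le_max_left _ _).trans (Nat.le_succ _)
        have hCm : (C : ℝ) ≤ ((max (τ + 1) C : ℕ) : ℝ) := by exact_mod_cast le_max_right _ _
        have h1 : OutputEnvelope f H α (τ + 1) (f τ d x u) (b (max (τ + 1) C)) :=
          .of_decay αm fun d' k => hb _ _ k (le_max_left _ _) _ d'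
            ((hC τ hτ d x u hx1 hu1).trans hCm)
        refine h1.mono αm (le_add_left ?_)
        rw [le_div_iff₀' (by norm_num)]
        exact le_add_left le_add_self)
  exact ⟨a, β, ha, fun τ x => (h τ _).1 x rfl, fun τ s => (h τ s).2.1,
    fun τ x u d v hx hu => (h τ _).2.2 x u d v hx hu rfl⟩

/-- Along forced trajectories, the Lyapunov function is dominated by the fading contribution of
the initial state or of one of the past inputs. -/
theorem exists_fading_memory (hf : HypA2 f) (hH : HypH2 H)
    (hR : IsRGAOS (fun t d x => f t d x 0) H) :
    ∃ (α a : ℝ≥0 → ℝ≥0) (β : ℕ → ℝ≥0), ClassKInfty α ∧ ClassKInfty a ∧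
      ∀ (u : ℕ → U) (t₀ : ℕ) (x₀ : X) (d : ℕ → D) (t : ℕ), t₀ ≤ t → ∃ v,
        OutputEnvelope f H α t (solution (fun s x => f s (d s) x (u s)) t₀ x₀ t) v ∧
        (v = (1 / 2) ^ (t - t₀) * a (β t₀ * ‖x₀‖₊) ∨
          ∃ τ, t₀ ≤ τ ∧ τ < t ∧ v = (1 / 2) ^ (t - τ) * a (β τ * ‖u τ‖₊)) := by
  obtain ⟨α, b, hα, hαg, hb⟩ := hR.exists_decay
  have αm : Monotone α := hα.1.2.1.monotone
  obtain ⟨h, hm, hh⟩ := hf.exists_reach_bound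
  -- With all data bounded by `m`, the sum dominates the envelope at every time `s ≤ m`; the factor
  -- `2 ^ m` compensates in advance for the fading over at most `m` steps.
  let Q : ℕ → ℝ≥0 := fun m => 2 ^ m * ∑ s ∈ Finset.range (m + 1), b (max s (h s m))
  obtain ⟨a, β, ha, hinit, hlarge, hstep⟩ :=
    exists_gain hf hH hα hαg hb (fun t => h t (t + 1)) Q
  refine ⟨α, a, β, hα, ha, fun u t₀ x₀ d t ht => ?_⟩
  induction t, ht using Nat.le_induction with
  | base =>
    rw [solution_initial]
    exact ⟨_, hinit t₀ x₀, Or.inl (by simp)⟩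
  | succ t ht ih =>
    obtain ⟨v, hv, hv'⟩ := ih
    set x := solution (fun s x => f s (d s) x (u s)) t₀ x₀ with hx
    obtain ⟨τ₀, hτ₀, hmax⟩ := (Finset.Icc t₀ t).exists_max_image (fun τ => ‖u τ‖₊)
      ⟨t₀, Finset.mem_Icc.2 ⟨le_rfl, ht⟩⟩
    obtain ⟨h₀, h₁⟩ := Finset.mem_Icc.1 hτ₀
    have hmax' : ∀ τ, t₀ ≤ τ → τ < t + 1 → ‖u τ‖₊ ≤ ‖u τ₀‖₊ := fun τ h2 h3 =>
      hmax τ (Finset.mem_Icc.2 ⟨h2, Nat.lt_succ_iff.1 h3⟩)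
    -- A dominant datum `M > t + 1` makes the induction hypothesis unnecessary: at most `⌈M⌉₊` steps
    -- have passed, so `Q ⌈M⌉₊` still dominates after fading.
    have large : ∀ (M : ℝ≥0) (τ : ℕ), (t : ℝ≥0) + 1 < M → ‖x₀‖₊ ≤ M → ‖u τ₀‖₊ ≤ M →
        OutputEnvelope f H α (t + 1) (x (t + 1)) ((1 / 2) ^ (t + 1 - τ) * a (β τ * M)) := by
      intro M τ hM hx₀ hu₀
      have hMm := Nat.le_ceil M
      have htm : t + 1 ≤ ⌈M⌉₊ := by exact_mod_cast hM.le.trans hMm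
      have hxb : ‖x (t + 1)‖ ≤ h (t + 1) ⌈M⌉₊ := hh u t₀ x₀ d ⌈M⌉₊ (t + 1) (ht.trans t.le_succ)
        (by exact_mod_cast hx₀.trans hMm)
        (fun τ h2 h3 => by exact_mod_cast ((hmax' τ h2 h3).trans hu₀).trans hMm)
      have henv : OutputEnvelope f H α (t + 1) (x (t + 1))
          (b (max (t + 1) (h (t + 1) ⌈M⌉₊))) :=
        .of_decay αm fun d' k => hb _ _ k (le_max_left _ _) _ d'
          (hxb.trans (by exact_mod_cast le_max_right _ _))
      refine henv.mono αm ?_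
      have h1 : 1 < M := lt_of_le_of_lt (by simp) hM
      calc b (max (t + 1) (h (t + 1) ⌈M⌉₊))
          ≤ ∑ s ∈ Finset.range (⌈M⌉₊ + 1), b (max s (h s ⌈M⌉₊)) :=
            Finset.single_le_sum (f := fun s => b (max s (h s ⌈M⌉₊))) (fun _ _ => zero_le)
              (Finset.mem_range.2 (Nat.lt_succ_of_le htm))
        _ = (1 / 2) ^ ⌈M⌉₊ * Q ⌈M⌉₊ := by
            simp only [Q]
            rw [← mul_assoc, ← mul_pow]
            simp
        _ ≤ (1 / 2) ^ (t + 1 - τ) * a (β τ * M) := by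
            refine mul_le_mul' (pow_le_pow_of_le_one zero_le ?_ (by omega)) (hlarge τ M h1)
            exact div_le_one_of_le₀ (by norm_num) (by norm_num)
    by_cases hM₁ : (t : ℝ≥0) + 1 < ‖x₀‖₊ ∧ ‖u τ₀‖₊ ≤ ‖x₀‖₊
    · exact ⟨_, large ‖x₀‖₊ t₀ hM₁.1 le_rfl hM₁.2, Or.inl rfl⟩
    by_cases hM₂ : (t : ℝ≥0) + 1 < ‖u τ₀‖₊
    · refine ⟨_, large ‖u τ₀‖₊ τ₀ hM₂ ?_ le_rfl, Or.inr ⟨τ₀, h₀, Nat.lt_succ_of_le h₁, rfl⟩⟩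
      by_contra! hlt
      exact hM₁ ⟨hM₂.trans hlt, hlt.le⟩
    have hu₀ : ‖u τ₀‖₊ ≤ (t : ℝ≥0) + 1 := not_lt.1 hM₂
    have hx₀ : ‖x₀‖₊ ≤ (t : ℝ≥0) + 1 := by
      by_contra! hlt
      exact hM₁ ⟨hlt, hu₀.trans hlt.le⟩
    have hxt : ‖x t‖ ≤ h t (t + 1) := hh u t₀ x₀ d (t + 1) t ht (by exact_mod_cast hx₀)
      (fun τ h2 h3 => by exact_mod_cast (hmax' τ h2 (h3.trans t.lt_succ_self)).trans hu₀)
    have hut : ‖u t‖ ≤ t + 1 := by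
      exact_mod_cast (hmax' t ht t.lt_succ_self).trans hu₀
    have henv := hstep t (x t) (u t) (d t) v hxt hut hv
    rw [← solution_step (fun s x => f s (d s) x (u s)) t₀ x₀ t ht] at henv
    -- The sum of two quarters is at most half the larger term, so a single term survives each step
    -- and no sum over past inputs accumulates.
    have hhalf : ∀ c e : ℝ≥0, e ≤ c → c / 4 + e / 4 ≤ 1 / 2 * c ∧ e / 4 + c / 4 ≤ 1 / 2 * c := by
      intro c e hec
      have : c / 4 + e / 4 ≤ 1 / 2 * c := by
        rw [← NNReal.coe_le_coe] at hec ⊢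
        push_cast
        linarith
      exact ⟨this, (add_comm _ _).trans_le this⟩
    rcases le_total (a (β t * ‖u t‖₊)) v with hle | hle
    · refine ⟨_, henv.mono αm (hhalf _ _ hle).1, ?_⟩
      rcases hv' with rfl | ⟨τ, h2, h3, rfl⟩
      · left
        rw [← mul_assoc, ← pow_succ', Nat.succ_sub ht]
      · right
        refine ⟨τ, h2, h3.trans t.lt_succ_self, ?_⟩
        rw [← mul_assoc, ← pow_succ', Nat.succ_sub h3.le]
    · exact ⟨_, henv.mono αm (hhalf _ _ hle).2, Or.inr ⟨t, ht, t.lt_succ_self, by simp⟩⟩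

theorem IsRGAOS.isIOS (hf : HypA2 f) (hH : HypH2 H)
    (hR : IsRGAOS (fun t d x => f t d x 0) H) : IsIOS f H := by
  obtain ⟨α, a, β, hα, ha, h⟩ := exists_fading_memory hf hH hR
  obtain ⟨β', hβ', hββ'⟩ := exists_classKPlus_ge β
  have am : Monotone a := ha.1.2.1.monotone
  have αm : Monotone α := hα.1.2.1.monotone
  -- The gain `β'` already carries the whole time dependence of the input term, so `γ` and `ρ` can
  -- be trivial.
  refine ⟨_, β', fun _ => 1, id, classKL_comp_exp hα.1 ha.1, hβ', ⟨continuous_const, by simp⟩,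
    ⟨⟨continuous_id, strictMono_id, rfl⟩, Filter.tendsto_id⟩, fun u t₀ x₀ d t ht => ?_⟩
  have : Nonempty D := ⟨d 0⟩
  have hle : ∀ (k τ : ℕ) (s : ℝ≥0), α ((1 / 2) ^ k * a (β τ * s)) ≤
      α ((1 / 2 : ℝ≥0) ^ (((k : ℝ≥0)) : ℝ) * a (β' τ * s)) := by
    intro k τ s
    rw [NNReal.coe_natCast, NNReal.rpow_natCast]
    exact αm (mul_le_mul_right (am (mul_le_mul_left (hββ' τ) s)) _)
  obtain ⟨v, hv, rfl | ⟨τ, h1, h2, rfl⟩⟩ := h u t₀ x₀ d t ht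
  · exact le_max_of_le_left (hv.output_le.trans (hle _ _ _))
  · refine le_max_of_le_right ((hv.output_le.trans (hle _ _ _)).trans ?_)
    simp only [id, one_mul]
    exact Finset.le_sup (f := fun τ : ℕ => α ((1 / 2 : ℝ≥0) ^ (((t - τ : ℕ) : ℝ≥0) : ℝ) *
      a (β' τ * ‖u τ‖₊))) (Finset.mem_Icc.2 ⟨h1, h2.le⟩)

end Main

theorem proposition3p3 {X Y U D : Type*}
    [NormedAddCommGroup X] [NormedSpace ℝ X]
    [NormedAddCommGroup Y] [NormedSpace ℝ Y]
    [NormedAddCommGroup U] [NormedSpace ℝ U]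
    (f : ℕ → D → X → U → X) (H : ℕ → X → Y)
    (hf : HypA2 f) (hH : HypH2 H) :
    IsIOS f H ↔ IsRGAOS (fun t d x => f t d x 0) H := by
  exact ⟨IsIOS.isRGAOS, IsRGAOS.isIOS hf hH⟩
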